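/- Let $\mathcal H$ be a separable complex Hilbert space (of finite or infinite dimension), and let $H$ and $G$ be two (not necessarily bounded) self-adjoint operators on $\mathcal H$ with pure point spectrum, i.e. for each of the two operators the eigenvectors span a dense subspace of $\mathcal H$. If $H$ and $G$ are not unitarily equivalent, i.e. if there is no unitary operator $W$ on $\mathcal H$ with $G = W H W^{*}$ (equality of domains included), then $$\sup_{t\in\mathbb R}\bigl\| e^{-itH} - e^{-itG}\bigr\| \ \ge\ \sqrt 2 ,$$ where $\|\cdot\|$ is the operator norm and $t\mapsto e^{-itH}$, $t\mapsto e^{-itG}$ are the strongly continuous one-parameter unitary groups generated by $H$ and $G$. -/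

import Mathlib

noncomputable section

set_option linter.unusedSectionVars false

namespace PurePointEvolution

variable {E : Type*} [NormedAddCommGroup E] [InnerProductSpace ℂ E]

/-- The eigenspace `ker (H - z)` of a (possibly unbounded) operator `H` at `z`. -/
def eigenspace (H : E →ₗ.[ℂ] E) (z : ℂ) : Submodule ℂ E where
  carrier := {x | ∃ hx : x ∈ H.domain, H ⟨x, hx⟩ = z • x}
  zero_mem' := ⟨H.domain.zero_mem, by
    have : (⟨0, H.domain.zero_mem⟩ : H.domain) = 0 := rfl
    rw [this, LinearPMap.map_zero, smul_zero]⟩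
  add_mem' := by
    rintro x y ⟨hx, hx'⟩ ⟨hy, hy'⟩
    refine ⟨H.domain.add_mem hx hy, ?_⟩
    have : (⟨x + y, H.domain.add_mem hx hy⟩ : H.domain) = ⟨x, hx⟩ + ⟨y, hy⟩ := rfl
    rw [this, LinearPMap.map_add, hx', hy', smul_add]
  smul_mem' := by
    rintro c x ⟨hx, hx'⟩
    refine ⟨H.domain.smul_mem c hx, ?_⟩
    have : (⟨c • x, H.domain.smul_mem c hx⟩ : H.domain) = c • ⟨x, hx⟩ := rfl
    rw [this, LinearPMap.map_smul, hx', smul_comm]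

/-- `H` has pure point spectrum: the eigenvectors of `H` span a dense subspace. -/
def HasPurePointSpectrum (H : E →ₗ.[ℂ] E) : Prop :=
  (⨆ z : ℂ, eigenspace H z).topologicalClosure = ⊤

/-- `H` and `G` are unitarily equivalent: `G = W H W⁻¹` for some unitary `W`, domains included. -/
def UnitarilyEquivalent (H G : E →ₗ.[ℂ] E) : Prop :=
  ∃ W : E ≃ₗᵢ[ℂ] E, (∀ x, W x ∈ G.domain ↔ x ∈ H.domain) ∧
    ∀ (x : H.domain) (hx : W x ∈ G.domain), G ⟨W x, hx⟩ = W (H x)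

variable [CompleteSpace E]

/-- `U` is the strongly continuous one-parameter unitary group generated by `H`, i.e.
`U t = exp (-i t H)` in the sense of Stone's theorem: the domain of `H` consists of the vectors
`x` whose orbit `t ↦ U t x` is differentiable at `0`, where its derivative is `-i H x`. -/
structure IsUnitaryGroupGeneratedBy (H : E →ₗ.[ℂ] E) (U : ℝ → E →L[ℂ] E) : Prop where
  mem_unitary : ∀ t, U t ∈ unitary (E →L[ℂ] E)
  map_zero : U 0 = 1
  map_add : ∀ s t, U (s + t) = U s * U t
  continuous_apply : ∀ x, Continuous fun t => U t x
  mem_domain_iff : ∀ x, x ∈ H.domain ↔ DifferentiableAt ℝ (fun t => U t x) 0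
  hasDerivAt : ∀ x : H.domain, HasDerivAt (fun t => U t x) (-Complex.I • H x) 0

open scoped Classical in
/-- The evolution `t ↦ exp (-i t H)`: the unitary group generated by `H`. It exists and is unique
if `H` is self-adjoint with pure point spectrum (`evolution_spec`, `evolution_unique`); the value
`0` is used only for operators that generate no unitary group. -/
def evolution (H : E →ₗ.[ℂ] E) : ℝ → E →L[ℂ] E :=
  if h : ∃ U, IsUnitaryGroupGeneratedBy H U then h.choose else 0

/-! ### Existence and uniqueness of the evolution -/

theorem symm_of_selfAdjoint {H : E →ₗ.[ℂ] E} (hH : IsSelfAdjoint H) (x y : H.domain) :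
    inner ℂ (H x) (y : E) = inner ℂ (x : E) (H y) := by
  have h := LinearPMap.adjoint_isFormalAdjoint (T := H) hH.dense_domain
  rw [LinearPMap.isSelfAdjoint_def.mp hH] at h
  exact h x y

theorem mem_domain_of_selfAdjoint {H : E →ₗ.[ℂ] E} (hH : IsSelfAdjoint H) (x w : E)
    (h : ∀ z : H.domain, inner ℂ w (z : E) = inner ℂ x (H z)) : x ∈ H.domain := by
  have h' := LinearPMap.mem_adjoint_domain_of_exists (T := H) x ⟨w, h⟩
  rwa [LinearPMap.isSelfAdjoint_def.mp hH] at h'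

theorem eigenvalue_real {H : E →ₗ.[ℂ] E} (hH : IsSelfAdjoint H) {z : ℂ} {x : E}
    (hx : x ∈ eigenspace H z) : ((z.re : ℝ) : ℂ) • x = z • x := by
  obtain ⟨hd, he⟩ := hx
  by_cases h0 : x = 0
  · simp [h0]
  have h := symm_of_selfAdjoint hH ⟨x, hd⟩ ⟨x, hd⟩
  simp only [he, inner_smul_left, inner_smul_right] at h
  have h2 := mul_right_cancel₀ (inner_self_ne_zero.mpr h0) h
  rw [Complex.conj_eq_iff_re.mp h2]

theorem eigenspace_orthogonal {H : E →ₗ.[ℂ] E} (hH : IsSelfAdjoint H) {z w : ℂ} (hzw : z ≠ w)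
    {x y : E} (hx : x ∈ eigenspace H z) (hy : y ∈ eigenspace H w) : inner ℂ x y = 0 := by
  have hx' := eigenvalue_real hH hx
  have hy' := eigenvalue_real hH hy
  by_cases hx0 : x = 0
  · simp [hx0]
  have hzr : ((z.re : ℝ) : ℂ) = z := smul_left_injective ℂ hx0 hx'
  obtain ⟨hd, he⟩ := hx
  obtain ⟨hd', he'⟩ := hy
  have h := symm_of_selfAdjoint hH ⟨x, hd⟩ ⟨y, hd'⟩
  simp only [he, he', inner_smul_left, inner_smul_right] at h
  rw [← hzr, Complex.conj_ofReal, hzr] at h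
  have : (z - w) * inner ℂ x y = 0 := by rw [sub_mul, h, sub_self]
  exact (mul_eq_zero.mp this).resolve_left (sub_ne_zero.mpr hzw)

theorem eigenspace_complete {H : E →ₗ.[ℂ] E} (hH : IsSelfAdjoint H) (z : ℂ) :
    CompleteSpace (eigenspace H z) := by
  have hset : (eigenspace H z : Set E) = (fun x : E => (x, z • x)) ⁻¹' (H.graph : Set (E × E)) := by
    ext x
    simp only [Set.mem_preimage, SetLike.mem_coe, LinearPMap.mem_graph_iff]
    constructor
    · rintro ⟨hx, h⟩
      exact ⟨⟨x, hx⟩, rfl, h⟩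
    · rintro ⟨y, hy, h⟩
      subst hy
      exact ⟨y.2, h⟩
  have hc : IsClosed (eigenspace H z : Set E) := by
    rw [hset]
    exact IsClosed.preimage (by fun_prop) hH.isClosed
  exact hc.completeSpace_coe

theorem eq_of_eqOn_eigenspaces {H : E →ₗ.[ℂ] E} (hp : HasPurePointSpectrum H) {A B : E →L[ℂ] E}
    (h : ∀ z, ∀ x ∈ eigenspace H z, A x = B x) : A = B := by
  have h1 : (⨆ z : ℂ, eigenspace H z) ≤ LinearMap.ker (A - B).toLinearMap :=
    iSup_le fun z x hx => by simp [h z x hx]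
  have h2 := Submodule.topologicalClosure_minimal _ h1 (A - B).isClosed_ker
  rw [hp] at h2
  ext x
  have := h2 (Submodule.mem_top : x ∈ ⊤)
  simpa [sub_eq_zero] using this

theorem eq_of_inner_eigenvectors {H : E →ₗ.[ℂ] E} (hp : HasPurePointSpectrum H) {a b : E}
    (h : ∀ z, ∀ x ∈ eigenspace H z, inner ℂ x a = inner ℂ x b) : a = b := by
  have hd : Dense ((⨆ z : ℂ, eigenspace H z : Submodule ℂ E) : Set E) :=
    (Submodule.dense_iff_topologicalClosure_eq_top).mpr hp
  have h1 : (⨆ z : ℂ, eigenspace H z) ≤ (ℂ ∙ (a - b))ᗮ :=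
    iSup_le fun z x hx => by
      rw [Submodule.mem_orthogonal_singleton_iff_inner_left, inner_sub_right, h z x hx, sub_self]
  refine hd.eq_of_inner_right ℂ fun v hv => ?_
  have := h1 hv
  rwa [Submodule.mem_orthogonal_singleton_iff_inner_left, inner_sub_right, sub_eq_zero] at this

/-- Multiplication by the phase `exp (-i t Re z)` on the eigenspace at `z`. -/
def phase (H : E →ₗ.[ℂ] E) (t : ℝ) (z : ℂ) : eigenspace H z →ₗᵢ[ℂ] E where
  toLinearMap := Complex.exp (-Complex.I * t * z.re) • (eigenspace H z).subtype
  norm_map' x := by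
    have : -Complex.I * t * z.re = ((-(t * z.re) : ℝ) : ℂ) * Complex.I := by push_cast; ring
    change ‖Complex.exp (-Complex.I * t * z.re) • (x : E)‖ = ‖(x : E)‖
    rw [norm_smul, this, Complex.norm_exp_ofReal_mul_I, one_mul]

theorem phase_apply (H : E →ₗ.[ℂ] E) (t : ℝ) (z : ℂ) (x : eigenspace H z) :
    phase H t z x = Complex.exp (-Complex.I * t * z.re) • (x : E) := rfl

theorem phase_range (H : E →ₗ.[ℂ] E) (t : ℝ) (z : ℂ) :
    LinearMap.range (phase H t z).toLinearMap = eigenspace H z := by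
  ext x
  constructor
  · rintro ⟨y, rfl⟩
    exact Submodule.smul_mem _ _ y.2
  · intro hx
    refine ⟨(Complex.exp (-Complex.I * t * z.re))⁻¹ • ⟨x, hx⟩, ?_⟩
    simp [phase_apply]

theorem phase_isHilbertSum {H : E →ₗ.[ℂ] E} (hH : IsSelfAdjoint H) (hp : HasPurePointSpectrum H)
    (t : ℝ) : IsHilbertSum ℂ (fun z => eigenspace H z) (phase H t) := by
  have := eigenspace_complete hH
  refine IsHilbertSum.mk (fun z w hzw x y => ?_) ?_
  · rw [phase_apply, phase_apply, inner_smul_left, inner_smul_right,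
      eigenspace_orthogonal hH hzw x.2 y.2, mul_zero, mul_zero]
  · simp only [phase_range]
    exact hp.ge

theorem exists_phase_unitary {H : E →ₗ.[ℂ] E} (hH : IsSelfAdjoint H)
    (hp : HasPurePointSpectrum H) (t : ℝ) : ∃ W : E →L[ℂ] E, W ∈ unitary (E →L[ℂ] E) ∧
      ∀ z, ∀ x ∈ eigenspace H z, W x = Complex.exp (-Complex.I * t * z) • x := by
  classical
  let e0 := (phase_isHilbertSum hH hp 0).linearIsometryEquiv
  let et := (phase_isHilbertSum hH hp t).linearIsometryEquiv
  refine ⟨_, (Unitary.linearIsometryEquiv.symm (e0.trans et.symm)).2, fun z x hx => ?_⟩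
  have h0 : e0.symm (lp.single 2 z ⟨x, hx⟩) = x := by
    simp only [e0, IsHilbertSum.linearIsometryEquiv_symm_apply_single, phase_apply]
    simp
  have h1 : et.symm (e0 x) = Complex.exp (-Complex.I * t * z) • x := by
    rw [← h0, LinearIsometryEquiv.apply_symm_apply, h0]
    simp only [et, IsHilbertSum.linearIsometryEquiv_symm_apply_single, phase_apply]
    have := eigenvalue_real hH hx
    by_cases hx0 : x = 0
    · simp [hx0]
    rw [smul_left_injective ℂ hx0 this]
  exact h1

theorem exists_unitaryGroup {H : E →ₗ.[ℂ] E} (hH : IsSelfAdjoint H)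
    (hp : HasPurePointSpectrum H) : ∃ U, IsUnitaryGroupGeneratedBy H U := by
  choose U hU hUe using exists_phase_unitary hH hp
  have hzero : U 0 = 1 := eq_of_eqOn_eigenspaces hp fun z x hx => by
    rw [hUe 0 z x hx]; simp
  have hadd : ∀ s t, U (s + t) = U s * U t := fun s t =>
    eq_of_eqOn_eigenspaces hp fun z x hx => by
      rw [mul_apply_eq_comp, hUe _ z x hx, hUe t z x hx, map_smul, hUe s z x hx,
        smul_smul, ← Complex.exp_add]
      congr 2
      push_cast
      ring
  have hnorm : ∀ t x, ‖U t x‖ = ‖x‖ := fun t x =>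
    ContinuousLinearMap.norm_map_of_mem_unitary (hU t) x
  have hcont : ∀ x, Continuous fun t => U t x := by
    let S : Submodule ℂ E :=
      { carrier := {x | Continuous fun t => U t x}
        zero_mem' := by simpa using continuous_const
        add_mem' := fun {x y} hx hy => by
          change Continuous fun t => U t (x + y)
          simp only [_root_.map_add]
          exact Continuous.add (M := E) hx hy
        smul_mem' := fun c x hx => by
          change Continuous fun t => U t (c • x)
          simp only [_root_.map_smul]
          exact Continuous.const_smul hx c }
    have hS : IsClosed (S : Set E) := by
      refine isClosed_of_closure_subset fun x hx => ?_
      change Continuous fun t => U t x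
      rw [Metric.mem_closure_iff] at hx
      refine Metric.continuous_iff.mpr fun t ε hε => ?_
      obtain ⟨y, hy, hxy⟩ := hx (ε / 3) (by positivity)
      obtain ⟨δ, hδ, h⟩ := Metric.continuous_iff.mp (show Continuous fun t => U t y from hy) t
        (ε / 3) (by positivity)
      refine ⟨δ, hδ, fun s hs => ?_⟩
      have h1 := h s hs
      have h2 : dist (U s x) (U s y) < ε / 3 := by
        rw [dist_eq_norm, ← map_sub, hnorm, ← dist_eq_norm]; exact hxy
      have h3 : dist (U t y) (U t x) < ε / 3 := by
        rw [dist_eq_norm, ← map_sub, hnorm, ← dist_eq_norm, dist_comm]; exact hxy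
      have h4 := dist_triangle4 (U s x) (U s y) (U t y) (U t x)
      linarith
    have h1 : (⨆ z : ℂ, eigenspace H z) ≤ S := iSup_le fun z x hx => by
      change Continuous fun t => U t x
      simp only [hUe _ z x hx]
      fun_prop
    have h2 := Submodule.topologicalClosure_minimal _ h1 hS
    rw [hp] at h2
    exact fun x => h2 (Submodule.mem_top : x ∈ ⊤)
  have hinner : ∀ t x y, inner ℂ (U (-t) x) y = inner ℂ x (U t y) := fun t x y => by
    have h1 : U t (U (-t) x) = x := by
      rw [← mul_apply_eq_comp, ← hadd, add_neg_cancel, hzero]; rfl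
    have h2 := ContinuousLinearMap.inner_map_map_of_mem_unitary (hU t) (U (-t) x) y
    rw [h1] at h2
    exact h2.symm
  have hderiv : ∀ x : H.domain, HasDerivAt (fun t => U t x) (-Complex.I • H x) 0 := by
    intro x
    have hc : Continuous fun s => -Complex.I • U s (H x) := (hcont (H x)).const_smul _
    have hI : ∀ t : ℝ, U t x = (x : E) + ∫ s in (0 : ℝ)..t, -Complex.I • U s (H x) := by
      intro t
      refine eq_of_inner_eigenvectors hp fun z v hv => ?_
      have hvr := eigenvalue_real hH hv
      by_cases hv0 : v = 0
      · simp [hv0]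
      have hzr : ((z.re : ℝ) : ℂ) = z := smul_left_injective ℂ hv0 hvr
      have hUv : ∀ (s : ℝ) (y : E),
          inner ℂ v (U s y) = Complex.exp (-Complex.I * s * z) * inner ℂ v y := fun s y => by
        rw [← hinner, hUe _ z v hv, inner_smul_left, ← Complex.exp_conj, ← hzr]
        simp
      have hvH : inner ℂ v (H x) = z * inner ℂ v (x : E) := by
        obtain ⟨hd, he⟩ := hv
        rw [← symm_of_selfAdjoint hH ⟨v, hd⟩ x, he, inner_smul_left, ← hzr, Complex.conj_ofReal]
      have hD : ∀ s : ℝ, HasDerivAt (fun r : ℝ => inner ℂ v (U r x))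
          (inner ℂ v (-Complex.I • U s (H x))) s := fun s => by
        have h1 : HasDerivAt (fun r : ℝ => Complex.exp (-Complex.I * r * z))
            (Complex.exp (-Complex.I * s * z) * (-Complex.I * 1 * z)) s :=
          (((Complex.ofRealCLM.hasDerivAt (x := s)).const_mul (-Complex.I)).mul_const z).cexp
        have h2 := h1.mul_const (inner ℂ v (x : E))
        simp only [hUv, inner_smul_right, hvH]
        have h6 : -Complex.I * (Complex.exp (-Complex.I * s * z) * (z * inner ℂ v (x : E))) =
            Complex.exp (-Complex.I * s * z) * (-Complex.I * 1 * z) * inner ℂ v (x : E) := by ring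
        rw [h6]
        exact h2
      have hcont2 : Continuous fun s => inner ℂ v (-Complex.I • U s (H x)) :=
        continuous_const.inner hc
      have h3 := intervalIntegral.integral_eq_sub_of_hasDerivAt (a := 0) (b := t)
        (fun s _ => hD s) (hcont2.intervalIntegrable _ _)
      have h4 := (innerSL ℂ v).intervalIntegral_comp_comm 
        (μ := MeasureTheory.volume) (hc.intervalIntegrable 0 t)
      simp only [innerSL_apply_apply] at h4
      rw [inner_add_right, ← h4, h3, hzero]
      simp
    have h5 := (intervalIntegral.integral_hasDerivAt_right
      (hc.intervalIntegrable (0 : ℝ) (0 : ℝ))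
      (hc.stronglyMeasurableAtFilter _ _) hc.continuousAt).const_add (x : E)
    simp only [hzero] at h5
    exact h5.congr_of_eventuallyEq (Filter.Eventually.of_forall hI)
  refine ⟨U, hU, hzero, hadd, hcont, fun x => ⟨fun hx => (hderiv ⟨x, hx⟩).differentiableAt,
    fun hx => ?_⟩, hderiv⟩
  refine mem_domain_of_selfAdjoint hH x (Complex.I • deriv (fun t => U t x) 0) fun y => ?_
  have h1 : HasDerivAt (fun t => inner ℂ (U t x) (y : E))
      (inner ℂ (deriv (fun t => U t x) 0) (y : E)) 0 := by
    simpa using hx.hasDerivAt.inner ℂ (hasDerivAt_const (0 : ℝ) (y : E))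
  have h2 : HasDerivAt (fun t : ℝ => inner ℂ x (U (-t) y)) (inner ℂ x (Complex.I • H y)) 0 := by
    have h3 : HasDerivAt (fun t : ℝ => U (-t) (y : E)) (Complex.I • H y) 0 := by
      have h4 := HasDerivAt.scomp (0 : ℝ) (h := fun t : ℝ => -t)
        (g₁ := fun t => U t (y : E)) (by simpa using hderiv y) (hasDerivAt_neg 0)
      simpa [Function.comp_def] using h4
    have h4 := (hasDerivAt_const (0 : ℝ) x).inner ℂ h3
    rwa [inner_zero_left, add_zero] at h4
  have h3 : (fun t => inner ℂ (U t x) (y : E)) = fun t : ℝ => inner ℂ x (U (-t) y) := by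
    funext t
    rw [← hinner (-t), neg_neg]
  rw [h3] at h1
  have h4 := h1.unique h2
  rw [inner_smul_left, h4, inner_smul_right, ← mul_assoc]
  simp

/-- The evolution of a self-adjoint `H` with pure point spectrum is the unitary group of `H`. -/
theorem evolution_spec {H : E →ₗ.[ℂ] E} (hH : IsSelfAdjoint H) (hp : HasPurePointSpectrum H) :
    IsUnitaryGroupGeneratedBy H (evolution H) := by
  have h := exists_unitaryGroup hH hp
  rw [evolution, dif_pos h]
  exact h.choose_spec

theorem IsUnitaryGroupGeneratedBy.apply_eigenvector {H : E →ₗ.[ℂ] E} {U : ℝ → E →L[ℂ] E}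
    (hU : IsUnitaryGroupGeneratedBy H U) {z : ℂ} {x : E} (hx : x ∈ eigenspace H z) (t : ℝ) :
    U t x = Complex.exp (-Complex.I * t * z) • x := by
  obtain ⟨hd, he⟩ := hx
  have hD : ∀ s, HasDerivAt (fun r => U r x) ((-Complex.I * z) • U s x) s := fun s => by
    have h1 : HasDerivAt (fun r => U (r - s) x) ((-Complex.I * z) • x) s := by
      have h0 := hU.hasDerivAt ⟨x, hd⟩
      rw [he, smul_smul] at h0
      have := HasDerivAt.comp_sub_const s s (f := fun r => U r x) (by simpa using h0)
      simpa using this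
    have h2 := ((U s).restrictScalars ℝ).hasFDerivAt.comp_hasDerivAt s h1
    have h3 : (fun r => U s (U (r - s) x)) = fun r => U r x := by
      funext r
      rw [← mul_apply_eq_comp, ← hU.map_add, add_sub_cancel]
    simpa [Function.comp_def, h3] using h2
  have hE : ∀ s : ℝ, HasDerivAt (fun r : ℝ => Complex.exp (Complex.I * r * z))
      (Complex.exp (Complex.I * s * z) * (Complex.I * 1 * z)) s := fun s =>
    (((Complex.ofRealCLM.hasDerivAt (x := s)).const_mul Complex.I).mul_const z).cexp
  have hc : ∀ s, HasDerivAt (fun r : ℝ => Complex.exp (Complex.I * r * z) • U r x) 0 s := fun s => by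
    have h5 := HasDerivAt.smul (hE s) (hD s)
    rw [smul_smul, ← add_smul] at h5
    have h6 : Complex.exp (Complex.I * s * z) * (-Complex.I * z) +
        Complex.exp (Complex.I * s * z) * (Complex.I * 1 * z) = 0 := by ring
    rw [h6, zero_smul] at h5
    exact h5
  have hconst := is_const_of_deriv_eq_zero (fun s => (hc s).differentiableAt)
    (fun s => (hc s).deriv) t 0
  simp only [hU.map_zero] at hconst
  have h4 : Complex.exp (-Complex.I * t * z) • (Complex.exp (Complex.I * t * z) • U t x)
      = Complex.exp (-Complex.I * t * z) • x := by
    rw [hconst]; simp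
  rw [smul_smul, ← Complex.exp_add] at h4
  simpa using h4

/-- A unitary group generated by a self-adjoint `H` with pure point spectrum is its evolution. -/
theorem evolution_unique {H : E →ₗ.[ℂ] E} (hH : IsSelfAdjoint H) (hp : HasPurePointSpectrum H)
    {U : ℝ → E →L[ℂ] E} (hU : IsUnitaryGroupGeneratedBy H U) : U = evolution H := by
  funext t
  refine eq_of_eqOn_eigenspaces hp fun z x hx => ?_
  rw [hU.apply_eigenvector hx, (evolution_spec hH hp).apply_eigenvector hx]

end PurePointEvolution

end

/-! ### Invariant mean on the real line. -/

open Filter Topology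
open scoped BoundedContinuousFunction

/-! Argue by contraposition: let `c` be the supremum and suppose `c < √2`. Write `U`, `V` for the
two groups. Both are isometric, so the polarization identity gives `Re ⟪U t x, V t x⟫ ≥ (1 - c ^ 2 /
2) ‖x‖ ^ 2`, with a positive constant. Averaging `⟪U t x, V t y⟫` over `t` with the mean of
`exists_invariant_mean` defines a bounded operator `A`, formally the mean of `V (-t) * U t`.
Positivity of the mean makes `A` coercive, hence invertible; translation invariance gives `A * U s =
V s * A` (`exists_isUnit_intertwining`). The unitary factor of `A` in its polar decomposition
intertwines the groups as well (`exists_unitary_intertwining`), hence their generators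
(`unitarilyEquivalent_of_intertwining`). -/

/-- A translation invariant mean on the bounded continuous functions on the real line. -/
theorem exists_invariant_mean : ∃ M : (ℝ →ᵇ ℂ) →ₗ[ℂ] ℂ, (∀ f, ‖M f‖ ≤ ‖f‖) ∧
    (∀ (f g : ℝ →ᵇ ℂ) (s : ℝ), (∀ t, g t = f (t + s)) → M g = M f) ∧
    ∀ (δ : ℝ) (f : ℝ →ᵇ ℂ), (∀ t, δ ≤ (f t).re) → δ ≤ (M f).re := by
  -- Along an ultrafilter finer than `atTop` every bounded family of averages converges, so the
  -- limit is defined for all `f` and linear in `f`.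
  let F : Ultrafilter ℝ := Ultrafilter.of atTop
  have hF : (F : Filter ℝ) ≤ atTop := Ultrafilter.of_le atTop
  have hpos : ∀ᶠ T in (F : Filter ℝ), 0 < T := hF (eventually_gt_atTop 0)
  let avg : (ℝ →ᵇ ℂ) → ℝ → ℂ := fun f T => (T⁻¹ : ℝ) • ∫ t in (0 : ℝ)..T, f t
  have hint : ∀ (f : ℝ →ᵇ ℂ) (a b : ℝ), IntervalIntegrable f MeasureTheory.volume a b :=
    fun f a b => f.continuous.intervalIntegrable a b
  have hbound : ∀ (f : ℝ →ᵇ ℂ) (T : ℝ), 0 < T → ‖avg f T‖ ≤ ‖f‖ := by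
    intro f T hT
    have h1 := intervalIntegral.norm_integral_le_of_norm_le_const (a := 0) (b := T) (f := f)
      (C := ‖f‖) fun t _ => f.norm_coe_le_norm t
    rw [sub_zero, abs_of_pos hT] at h1
    rw [norm_smul, Real.norm_of_nonneg (inv_nonneg.mpr hT.le), inv_mul_le_iff₀ hT, mul_comm]
    exact h1
  have hlim : ∀ f : ℝ →ᵇ ℂ, ∃ z, Tendsto (avg f) F (𝓝 z) := by
    intro f
    have hmem : Metric.closedBall (0 : ℂ) ‖f‖ ∈ F.map (avg f) :=
      hpos.mono fun T hT => mem_closedBall_zero_iff.mpr (hbound f T hT)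
    obtain ⟨z, -, hz⟩ := (isCompact_closedBall (0 : ℂ) ‖f‖).ultrafilter_le_nhds (F.map (avg f))
      (le_principal_iff.mpr hmem)
    exact ⟨z, hz⟩
  choose L hL using hlim
  refine ⟨{ toFun := L, map_add' := fun f g => ?_, map_smul' := fun c f => ?_ },
    fun f => ?_, fun f g s hfg => ?_, fun δ f hf => ?_⟩
  · refine tendsto_nhds_unique (hL (f + g)) (((hL f).add (hL g)).congr fun T => ?_)
    simp only [avg, BoundedContinuousFunction.coe_add, Pi.add_apply]
    rw [intervalIntegral.integral_add (hint f _ _) (hint g _ _), smul_add]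
  · refine tendsto_nhds_unique (hL (c • f)) (((hL f).const_smul c).congr fun T => ?_)
    simp only [avg, BoundedContinuousFunction.coe_smul]
    rw [intervalIntegral.integral_smul, smul_comm]
  · exact le_of_tendsto (hL f).norm (hpos.mono (hbound f))
  · refine tendsto_nhds_unique (hL g) ?_
    -- Translation by `s` changes the integral over `[0, T]` only by two boundary integrals of
    -- length `|s|`, which the factor `T⁻¹` kills.
    have hdiff : Tendsto (fun T => avg g T - avg f T) F (𝓝 0) := by
      have h0 : Tendsto (fun T : ℝ => T⁻¹ * (2 * (‖f‖ * |s|))) F (𝓝 0) := by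
        simpa using (tendsto_inv_atTop_zero.mono_left hF).mul_const (2 * (‖f‖ * |s|))
      refine squeeze_zero_norm' (hpos.mono fun T hT => ?_) h0
      have h1 : (∫ t in (0 : ℝ)..T, g t) - ∫ t in (0 : ℝ)..T, f t =
          (∫ t in T..(T + s), f t) - ∫ t in (0 : ℝ)..s, f t := by
        simp only [hfg, intervalIntegral.integral_comp_add_right, zero_add]
        have h2 := intervalIntegral.integral_add_adjacent_intervals (hint f 0 s) (hint f s (T + s))
        have h3 := intervalIntegral.integral_add_adjacent_intervals (hint f 0 T) (hint f T (T + s))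
        linear_combination h2 - h3
      have h4 := intervalIntegral.norm_integral_le_of_norm_le_const (a := T) (b := T + s) (f := f)
        (C := ‖f‖) fun t _ => f.norm_coe_le_norm t
      have h5 := intervalIntegral.norm_integral_le_of_norm_le_const (a := 0) (b := s) (f := f)
        (C := ‖f‖) fun t _ => f.norm_coe_le_norm t
      rw [add_sub_cancel_left] at h4
      rw [sub_zero] at h5
      simp only [avg]
      rw [← smul_sub, h1, norm_smul, Real.norm_of_nonneg (inv_nonneg.mpr hT.le)]
      gcongr
      linarith [norm_sub_le (∫ t in T..(T + s), f t) (∫ t in (0 : ℝ)..s, f t)]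
    simpa using hdiff.add (hL f)
  · refine ge_of_tendsto ((Complex.continuous_re.tendsto _).comp (hL f)) (hpos.mono fun T hT => ?_)
    have h1 : (∫ t in (0 : ℝ)..T, f t).re = ∫ t in (0 : ℝ)..T, (f t).re :=
      (Complex.reCLM.intervalIntegral_comp_comm (hint f 0 T)).symm
    have h2 := intervalIntegral.integral_mono_on (μ := MeasureTheory.volume) hT.le
      (intervalIntegrable_const (c := δ))
      ((Complex.continuous_re.comp f.continuous).intervalIntegrable 0 T) fun t _ => hf t
    rw [intervalIntegral.integral_const, sub_zero, smul_eq_mul] at h2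
    simp only [avg, Function.comp_apply, Complex.smul_re, smul_eq_mul, h1]
    rwa [le_inv_mul_iff₀ hT]

/-! ### Polar decomposition. -/

/-- The unitary part of the polar decomposition of an invertible element intertwines everything
that the element intertwines together with the adjoints. -/
theorem exists_unitary_intertwining {A : Type*} [CStarAlgebra A] [PartialOrder A]
    [StarOrderedRing A] {a : A} (ha : IsUnit a) :
    ∃ w ∈ unitary A, ∀ u v : A, a * u = v * a → a * star u = star v * a → w * u = v * w := by
  have hp : IsUnit (CFC.abs a) :=
    (CFC.isUnit_sqrt_iff (star a * a) (star_mul_self_nonneg a)).mpr (ha.star.mul ha)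
  have hsq := CFC.abs_mul_abs a
  have hsa : star (CFC.abs a) = CFC.abs a := (CFC.abs_nonneg a).isSelfAdjoint
  have hcomm : ∀ u v : A, a * u = v * a → a * star u = star v * a → Commute (CFC.abs a) u := by
    intro u v h h'
    -- Then `star a * a * u = star a * v * a = u * star a * a`, and the functional calculus carries
    -- this commutation over to the square root.
    have h2 : u * star a = star a * v := by simpa using congr_arg star h'
    refine Commute.cfcₙ_nnreal (a := star a * a) ?_ NNReal.sqrt
    rw [commute_iff_eq, mul_assoc, h, ← mul_assoc, ← h2, mul_assoc]
  obtain ⟨p, hp⟩ := hp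
  rw [← hp] at hsq hsa hcomm
  have hsi : star (↑p⁻¹ : A) = ↑p⁻¹ := by
    have h1 : star p = p := Units.ext hsa
    rw [← Units.coe_star_inv, h1]
  have hw : star (a * ↑p⁻¹) * (a * ↑p⁻¹) = 1 := by
    rw [star_mul, hsi, mul_assoc, ← mul_assoc (star a), ← hsq]
    simp [mul_assoc]
  have hu : IsUnit (a * ↑p⁻¹) := ha.mul p⁻¹.isUnit
  refine ⟨a * ↑p⁻¹, Unitary.mem_iff.mpr ⟨hw, ?_⟩, fun u v h h' => ?_⟩
  -- For an invertible element a left inverse is also a right inverse.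
  · obtain ⟨q, hq⟩ := hu
    rw [← hq] at hw ⊢
    rw [q.mul_eq_one_iff_eq_inv.mp hw, q.mul_inv]
  · rw [mul_assoc, (hcomm u v h h').units_inv_left.eq, ← mul_assoc, h, mul_assoc]

/-! ### Intertwining operators between unitary groups. -/

namespace PurePointEvolution

variable {E : Type*} [NormedAddCommGroup E] [InnerProductSpace ℂ E] [CompleteSpace E]

theorem IsUnitaryGroupGeneratedBy.star_apply {H : E →ₗ.[ℂ] E} {U : ℝ → E →L[ℂ] E}
    (hU : IsUnitaryGroupGeneratedBy H U) (t : ℝ) : star (U t) = U (-t) := by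
  have h1 : U t * U (-t) = 1 := by rw [← hU.map_add, add_neg_cancel, hU.map_zero]
  exact left_inv_eq_right_inv (Unitary.mem_iff.mp (hU.mem_unitary t)).1 h1

theorem IsUnitaryGroupGeneratedBy.norm_apply {H : E →ₗ.[ℂ] E} {U : ℝ → E →L[ℂ] E}
    (hU : IsUnitaryGroupGeneratedBy H U) (t : ℝ) (x : E) : ‖U t x‖ = ‖x‖ :=
  ContinuousLinearMap.norm_map_of_mem_unitary (hU.mem_unitary t) x

/-- Generators of unitarily conjugate groups are unitarily equivalent. -/
theorem unitarilyEquivalent_of_intertwining {H G : E →ₗ.[ℂ] E} {U V : ℝ → E →L[ℂ] E}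
    (hU : IsUnitaryGroupGeneratedBy H U) (hV : IsUnitaryGroupGeneratedBy G V) {W : E →L[ℂ] E}
    (hW : W ∈ unitary (E →L[ℂ] E)) (h : ∀ t, W * U t = V t * W) : UnitarilyEquivalent H G := by
  have h1 : ∀ x, (fun t => V t (W x)) = fun t => W (U t x) := fun x => funext fun t => by
    simpa using (DFunLike.congr_fun (h t) x).symm
  have h2 : ∀ x, (fun t => U t x) = fun t => star W (V t (W x)) := fun x => funext fun t => by
    have h3 : star W * (V t * W) = U t := by
      rw [← h t, ← mul_assoc, (Unitary.mem_iff.mp hW).1, one_mul]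
    simpa using (DFunLike.congr_fun h3 x).symm
  refine ⟨Unitary.linearIsometryEquiv ⟨W, hW⟩, fun x => ?_, fun x hx => ?_⟩
  -- Domains are read off from differentiability of orbits at `0`, which the bounded maps `W` and
  -- `star W` preserve.
  · change W x ∈ G.domain ↔ _
    rw [hV.mem_domain_iff, hU.mem_domain_iff]
    refine ⟨fun hd => ?_, fun hd => ?_⟩
    · rw [h2]
      exact ((star W).restrictScalars ℝ).differentiableAt.comp (0 : ℝ) hd
    · rw [h1]
      exact (W.restrictScalars ℝ).differentiableAt.comp (0 : ℝ) hd
  · change W x ∈ G.domain at hx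
    change G ⟨W x, hx⟩ = W (H x)
    have h3 := hV.hasDerivAt ⟨W x, hx⟩
    have h4 := (W.restrictScalars ℝ).hasFDerivAt.comp_hasDerivAt (0 : ℝ) (hU.hasDerivAt x)
    simp only [h1] at h3
    have h5 := h3.unique h4
    simp only [ContinuousLinearMap.coe_restrictScalars', map_smul] at h5
    exact smul_right_injective E (neg_ne_zero.mpr Complex.I_ne_zero) h5

/-- The mean of `V (-t) * U t` over an invariant mean: an operator intertwining `U` and `V`,
which is invertible if the two groups stay uniformly close to each other. -/
theorem exists_isUnit_intertwining {H G : E →ₗ.[ℂ] E} {U V : ℝ → E →L[ℂ] E}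
    (hU : IsUnitaryGroupGeneratedBy H U) (hV : IsUnitaryGroupGeneratedBy G V) {δ : ℝ} (hδ : 0 < δ)
    (h : ∀ t x, δ * ‖x‖ ^ 2 ≤ (inner ℂ (U t x) (V t x)).re) :
    ∃ A : E →L[ℂ] E, IsUnit A ∧ ∀ t, A * U t = V t * A := by
  obtain ⟨M, hM, hMs, hMre⟩ := exists_invariant_mean
  let c : E → E → ℝ →ᵇ ℂ := fun x y => BoundedContinuousFunction.ofNormedAddCommGroup
    (fun t => inner ℂ (U t x) (V t y)) ((hU.continuous_apply x).inner (hV.continuous_apply y))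
    (‖x‖ * ‖y‖) fun t => (norm_inner_le_norm _ _).trans_eq (by
      rw [hU.norm_apply, hV.norm_apply])
  have hc : ∀ x y t, c x y t = inner ℂ (U t x) (V t y) := fun _ _ _ => rfl
  have hcn : ∀ x y, ‖c x y‖ ≤ ‖x‖ * ‖y‖ := fun x y =>
    BoundedContinuousFunction.norm_ofNormedAddCommGroup_le _ (by positivity) _
  let B₀ : E →ₗ⋆[ℂ] E →ₗ[ℂ] ℂ := LinearMap.mk₂'ₛₗ (starRingEnd ℂ) (RingHom.id ℂ)
    (fun x y => M (c x y))
    (fun x x' y => by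
      rw [← map_add]; congr 1; ext t; simp [hc])
    (fun a x y => by
      rw [← map_smul]; congr 1; ext t; simp [hc, mul_comm])
    (fun x y y' => by
      rw [← map_add]; congr 1; ext t; simp [hc])
    (fun a x y => by
      rw [RingHom.id_apply, ← map_smul]; congr 1; ext t; simp [hc])
  let B : E →L⋆[ℂ] E →L[ℂ] ℂ := B₀.mkContinuous₂ 1 fun x y => by
    rw [one_mul]
    exact (hM _).trans (hcn x y)
  let A : E →L[ℂ] E := InnerProductSpace.continuousLinearMapOfBilin B
  have hA : ∀ x y, inner ℂ (A x) y = M (c x y) := fun x y =>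
    InnerProductSpace.continuousLinearMapOfBilin_apply B x y
  refine ⟨A, ?_, fun s => ?_⟩
  -- Lax–Milgram: the mean preserves the lower bound `δ * ‖x‖ ^ 2` on the real part.
  · refine ContinuousLinearMap.isUnit_of_forall_le_norm_inner_map A (c := ⟨δ, hδ.le⟩) hδ fun x => ?_
    rw [hA]
    refine le_trans ?_ (Complex.re_le_norm _)
    exact (mul_comm _ _).trans_le (hMre (δ * ‖x‖ ^ 2) (c x x) fun t => h t x)
  · ext x
    refine ext_inner_right ℂ fun y => ?_
    have h1 : inner ℂ (V s (A x)) y = inner ℂ (A x) (V (-s) y) := by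
      rw [← hV.star_apply, ContinuousLinearMap.star_eq_adjoint,
        ContinuousLinearMap.adjoint_inner_right]
    change inner ℂ (A (U s x)) y = inner ℂ (V s (A x)) y
    rw [h1, hA, hA]
    -- Both coefficients agree up to a shift by `s`, since `V (t + s) * V (-s) = V t`.
    refine hMs _ _ s fun t => ?_
    rw [hc, hc, hU.map_add, ← mul_apply_eq_comp, ← mul_apply_eq_comp, ← hV.map_add]
    congr 3
    ring

end PurePointEvolution

/-! ### The bound by `√2`. -/

theorem mainTheorem12 {E : Type*} [NormedAddCommGroup E] [InnerProductSpace ℂ E]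
    [CompleteSpace E] [TopologicalSpace.SeparableSpace E]
    (H G : E →ₗ.[ℂ] E) (hH : IsSelfAdjoint H) (hG : IsSelfAdjoint G)
    (hHp : PurePointEvolution.HasPurePointSpectrum H)
    (hGp : PurePointEvolution.HasPurePointSpectrum G)
    (hHG : ¬ PurePointEvolution.UnitarilyEquivalent H G) :
    BddAbove (Set.range fun t : ℝ =>
      ‖PurePointEvolution.evolution H t - PurePointEvolution.evolution G t‖) ∧
    Real.sqrt 2 ≤
      ⨆ t : ℝ, ‖PurePointEvolution.evolution H t - PurePointEvolution.evolution G t‖ := by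
  have hU := PurePointEvolution.evolution_spec hH hHp
  have hV := PurePointEvolution.evolution_spec hG hGp
  set U := PurePointEvolution.evolution H
  set V := PurePointEvolution.evolution G
  -- Boundedness matters because a real supremum over an unbounded set is `0` by convention.
  have hbdd : BddAbove (Set.range fun t : ℝ => ‖U t - V t‖) := by
    refine ⟨2, ?_⟩
    rintro _ ⟨t, rfl⟩
    refine ContinuousLinearMap.opNorm_le_bound _ zero_le_two fun x => ?_
    have := norm_sub_le (U t x) (V t x)
    rw [hU.norm_apply, hV.norm_apply] at this
    rw [sub_apply]
    linarith
  refine ⟨hbdd, le_of_not_gt fun hlt => hHG ?_⟩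
  set c := ⨆ t : ℝ, ‖U t - V t‖
  have hle : ∀ t, ‖U t - V t‖ ≤ c := le_ciSup hbdd
  have hc0 : 0 ≤ c := (norm_nonneg _).trans (hle 0)
  have hc2 : c ^ 2 < 2 := (Real.lt_sqrt hc0).mp hlt
  -- This `δ` comes from `‖U t x - V t x‖ ^ 2 = 2 * ‖x‖ ^ 2 - 2 * Re ⟪U t x, V t x⟫`; it is positive
  -- exactly when `c < √2`.
  obtain ⟨A, hA, hAi⟩ := PurePointEvolution.exists_isUnit_intertwining hU hV (δ := 1 - c ^ 2 / 2) (by linarith)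
    fun t x => by
      have h1 : ‖U t x - V t x‖ ≤ c * ‖x‖ := (U t - V t).le_of_opNorm_le (hle t) x
      have h2 : ‖U t x - V t x‖ ^ 2 ≤ (c * ‖x‖) ^ 2 := by gcongr
      have h3 := norm_sub_sq (𝕜 := ℂ) (U t x) (V t x)
      rw [hU.norm_apply, hV.norm_apply, RCLike.re_eq_complex_re] at h3
      linarith
  obtain ⟨W, hW, hWi⟩ := exists_unitary_intertwining hA
  refine PurePointEvolution.unitarilyEquivalent_of_intertwining hU hV hW fun t => hWi _ _ (hAi t) ?_
  -- The adjoint relation is the intertwining relation at time `-t`.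
  rw [hU.star_apply, hV.star_apply, hAi]
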